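/- All graphs are finite and simple. For a graph $G$ on $n$ vertices and an interval $I$, let $m_G I$ denote the number of eigenvalues, counted with multiplicity, of the Laplacian matrix $L(G)=D(G)-A(G)$ that lie in $I$. For $n\ge 5$ consider a path $v_1v_2v_3v_4$ and a vertex-disjoint complete graph $K_{n-4}$, and define the following graphs on these $n$ vertices, each of which contains all edges of the path and of $K_{n-4}$. - $G_{n,3}$ is obtained by joining every vertex of $K_{n-4}$ to $v_2$, $v_3$ and $v_4$. - For $1\le s\le n-4$, $G_{n,3}^{(2,s)}$ (respectively $G_{n,3}^{(4,s)}$) is obtained from $G_{n,3}$ by deleting the edges between $v_2$ (respectively $v_4$) and $s$ of the vertices of $K_{n-4}$. - For $1\le a\le n-5$, $G^{n,a}$ is obtained by joining every vertex of $K_{n-4}$ to $v_2$ and $v_3$, joining $a$ vertices of $K_{n-4}$ to $v_1$, and joining the remaining $n-4-a$ vertices of $K_{n-4}$ to $v_4$. - For $a,b\ge 1$ with $a+b\le n-4$, $G^{n,a,b}$ is obtained by joining every vertex of $K_{n-4}$ to $v_2$ and $v_3$, joining $a$ vertices of $K_{n-4}$ to $v_1$, and joining $b$ other vertices of $K_{n-4}$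 to $v_4$. Up to isomorphism these do not depend on which vertices of $K_{n-4}$ are chosen. **Theorem.** Let $G$ be an $n$-vertex graph with diameter $3$, where $n\ge 5$. Then $m_G[n-2,n]\le n-3$. Equality holds if and only if $G$ is isomorphic to one of the following graphs: $G_{n,3}$; $G_{n,3}^{(2,s)}$ with $1\le s\le n-4$; $G_{n,3}^{(4,s)}$ with $1\le s\le n-4$; $G^{n,a}$ with $1\le a\le \frac n2-2$; $G^{n,a,b}$ with $1\le a\le b$ and $a+b\le n-5$. -/

import Mathlib

/-- `laplacianCount G I` is the number of Laplacian eigenvalues of the finite graph `G` lying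
in `I`, counted with multiplicity (usually written `m_G I`).  Here `eigenvalues` lists all the
eigenvalues of the Laplacian matrix `D - A`, each as often as its multiplicity. -/
noncomputable def laplacianCount {V : Type*} [Fintype V] [DecidableEq V] (G : SimpleGraph V)
    [DecidableRel G.Adj] (I : Set ℝ) : ℕ :=
  Set.ncard {i : V | (SimpleGraph.posSemidef_lapMatrix ℝ G).isHermitian.eigenvalues i ∈ I}

/-- The graph obtained from a path on `k` vertices (left summand, in path order) and a disjoint
complete graph on `m` vertices (right summand) by joining the path vertex `i` to the clique
vertex `j` whenever `R i j` holds. -/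
def pathCliqueGraph (k m : ℕ) (R : Fin k → Fin m → Prop) : SimpleGraph (Fin k ⊕ Fin m) where
  Adj
    | Sum.inl i, Sum.inl j => (SimpleGraph.pathGraph k).Adj i j
    | Sum.inr i, Sum.inr j => i ≠ j
    | Sum.inl i, Sum.inr j => R i j
    | Sum.inr j, Sum.inl i => R i j
  symm := ⟨by
    rintro (i | i) (j | j) h
    · exact SimpleGraph.Adj.symm h
    · exact h
    · exact h
    · exact Ne.symm h⟩
  loopless := ⟨by
    rintro (i | i) h
    · exact SimpleGraph.irrefl _ h
    · exact h rfl⟩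

/-- `G_{n,d,t}`: a path `v_1 … v_{d+1}` and a complete graph on `n - d - 1` vertices, all of
whose vertices are joined to `v_{t-1}`, `v_t`, `v_{t+1}`.  The vertex `v_{i+1}` is `Sum.inl i`. -/
def graphNDT (n d t : ℕ) : SimpleGraph (Fin (d + 1) ⊕ Fin (n - d - 1)) :=
  pathCliqueGraph (d + 1) (n - d - 1) fun i _ =>
    (i : ℕ) + 1 = t - 1 ∨ (i : ℕ) + 1 = t ∨ (i : ℕ) + 1 = t + 1

/-- `G_{n,3} = G_{n,3,3}`: here `v_2, v_3, v_4` are joined to all vertices outside the path, and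
`v_1` has degree one. -/
def graphN3 (n : ℕ) : SimpleGraph (Fin 4 ⊕ Fin (n - 4)) := graphNDT n 3 3

/-- `G_{n,3}^{(2,s)}`: remove from `G_{n,3}` the edges between `v_2` and `s` of the vertices
outside the path (the clique vertices are interchangeable, so we take the first `s`). -/
def graphN3Two (n s : ℕ) : SimpleGraph (Fin 4 ⊕ Fin (n - 4)) :=
  (graphN3 n).deleteEdges {e | ∃ j : Fin (n - 4), (j : ℕ) < s ∧ e = s(Sum.inl 1, Sum.inr j)}

/-- `G_{n,3}^{(4,s)}`: remove from `G_{n,3}` the edges between `v_4` and `s` of the vertices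
outside the path. -/
def graphN3Four (n s : ℕ) : SimpleGraph (Fin 4 ⊕ Fin (n - 4)) :=
  (graphN3 n).deleteEdges {e | ∃ j : Fin (n - 4), (j : ℕ) < s ∧ e = s(Sum.inl 3, Sum.inr j)}

/-- `G^{n,a}`: a path `v_1 v_2 v_3 v_4` and a complete graph on `n - 4` vertices, all of whose
vertices are joined to `v_2` and `v_3`, where `a` of them are joined to `v_1` and the remaining
`n - 4 - a` to `v_4`. -/
def graphNA (n a : ℕ) : SimpleGraph (Fin 4 ⊕ Fin (n - 4)) :=
  pathCliqueGraph 4 (n - 4) fun i j =>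
    i = 1 ∨ i = 2 ∨ (i = 0 ∧ (j : ℕ) < a) ∨ (i = 3 ∧ a ≤ (j : ℕ))

/-- `G^{n,a,b}`: a path `v_1 v_2 v_3 v_4` and a complete graph on `n - 4` vertices, all of whose
vertices are joined to `v_2` and `v_3`, where `a` of them are joined to `v_1` and `b` others
to `v_4`. -/
def graphNAB (n a b : ℕ) : SimpleGraph (Fin 4 ⊕ Fin (n - 4)) :=
  pathCliqueGraph 4 (n - 4) fun i j =>
    i = 1 ∨ i = 2 ∨ (i = 0 ∧ (j : ℕ) < a) ∨ (i = 3 ∧ a ≤ (j : ℕ) ∧ (j : ℕ) < a + b)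

/-! The Laplacians of `G` and its complement add up to `nI - J`. Hence all eigenvalues of `G` are at
most `n`, and those below `n - 2` are the eigenvalue 0 of the constant vectors together with one for
each eigenvalue of the complement above 2. The theorem thus says that the complement has at least
two eigenvalues above 2, and describes when it has exactly two.

Let `u, a, b, v` be a geodesic. The complement contains the path `b - u - v - a`, and since `u` and
`v` have no common neighbour in `G`, it joins any fifth vertex to `u` or `v`. The resulting tree
forces two eigenvalues above 2, which is the bound (`IsGeodesicThree.laplacianCount_add_two_lt`).

Two further subgraphs of the complement, a triangle with a tail and a 4-cycle with two pendants,
would force three such eigenvalues. Excluding them makes `G` complete off one of the pairs `{u, v}`,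
`{u, a}`, `{v, b}` (`isCliqueOff_or`), and counting neighbours outside the geodesic then identifies
the family. Conversely, if `G` is complete off two vertices, two vertices meet every edge of the
complement, so its form is at most 2 on a space of codimension at most 3
(`card_sub_three_le_laplacianCount`). -/

section

open Matrix Finset

/-! ### Counting eigenvalues by test spaces. -/

section Spectral

variable {V : Type*} [Fintype V] [DecidableEq V]

lemma Matrix.IsHermitian.sum_inner_eigenvectorBasis_sq {A : Matrix V V ℝ} (hA : A.IsHermitian)
    (x : V → ℝ) :
    ∑ i, (hA.eigenvectorBasis i ⬝ᵥ x) ^ 2 = x ⬝ᵥ x := by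
  have h := hA.eigenvectorBasis.sum_inner_mul_inner (WithLp.toLp 2 x) (WithLp.toLp 2 x)
  simp only [EuclideanSpace.inner_eq_star_dotProduct, star_trivial] at h
  rw [← h]
  refine Finset.sum_congr rfl fun i _ => ?_
  rw [dotProduct_comm x, sq]

lemma Matrix.IsHermitian.sum_eigenvalues_mul_inner_sq {A : Matrix V V ℝ} (hA : A.IsHermitian)
    (x : V → ℝ) :
    ∑ i, hA.eigenvalues i * (hA.eigenvectorBasis i ⬝ᵥ x) ^ 2 = x ⬝ᵥ A *ᵥ x := by
  have h := hA.eigenvectorBasis.sum_inner_mul_inner (WithLp.toLp 2 x) (WithLp.toLp 2 (A *ᵥ x))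
  simp only [EuclideanSpace.inner_eq_star_dotProduct, star_trivial] at h
  rw [dotProduct_comm x, ← h]
  refine Finset.sum_congr rfl fun i _ => ?_
  have hT : Aᵀ = A := by simpa using hA.eq
  have : (A *ᵥ x) ⬝ᵥ hA.eigenvectorBasis i
      = hA.eigenvalues i * (hA.eigenvectorBasis i ⬝ᵥ x) := by
    rw [dotProduct_comm, dotProduct_mulVec, ← mulVec_transpose, hT, hA.mulVec_eigenvectorBasis,
      smul_dotProduct, smul_eq_mul]
  rw [this]
  ring

/-- A linear family on which the quadratic form of `A` stays below `t` bounds from below the number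
of eigenvalues less than `t`. -/
lemma Matrix.IsHermitian.finrank_le_card_eigenvalues_lt {A : Matrix V V ℝ} (hA : A.IsHermitian)
    {E : Type*} [AddCommGroup E] [Module ℝ E] (T : E →ₗ[ℝ] V → ℝ) (t : ℝ)
    (h : ∀ c, c ≠ 0 → T c ⬝ᵥ A *ᵥ T c < t * (T c ⬝ᵥ T c)) :
    Module.finrank ℝ E ≤ #{i | hA.eigenvalues i < t} := by
  -- `F` records the components along eigenvectors with eigenvalue below `t`. If all of them vanish,
  -- the form is at least `t` times the squared norm.
  let F : E →ₗ[ℝ] {i // hA.eigenvalues i < t} → ℝ :=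
    LinearMap.pi fun i => (dotProductBilin ℝ ℝ (hA.eigenvectorBasis i : V → ℝ)).comp T
  have hF : Function.Injective F := by
    rw [injective_iff_map_eq_zero]
    intro c hc
    by_contra h0
    refine (h c h0).not_ge ?_
    rw [← hA.sum_eigenvalues_mul_inner_sq, ← hA.sum_inner_eigenvectorBasis_sq, Finset.mul_sum]
    refine Finset.sum_le_sum fun i _ => ?_
    by_cases hi : hA.eigenvalues i < t
    · have : (hA.eigenvectorBasis i : V → ℝ) ⬝ᵥ T c = 0 := congrFun hc ⟨i, hi⟩
      simp [this]
    · exact mul_le_mul_of_nonneg_right (not_lt.1 hi) (sq_nonneg _)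
  have := LinearMap.finrank_le_finrank_of_injective hF
  rwa [Module.finrank_fintype_fun_eq_card, Fintype.card_subtype] at this

/-- An injective linear family on which the quadratic form of `A` is at least `t` bounds from below
the number of eigenvalues that are at least `t`. -/
lemma Matrix.IsHermitian.finrank_le_card_le_eigenvalues {A : Matrix V V ℝ} (hA : A.IsHermitian)
    {E : Type*} [AddCommGroup E] [Module ℝ E] (T : E →ₗ[ℝ] V → ℝ) (hT : Function.Injective T)
    (t : ℝ) (h : ∀ c, t * (T c ⬝ᵥ T c) ≤ T c ⬝ᵥ A *ᵥ T c) :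
    Module.finrank ℝ E ≤ #{i | t ≤ hA.eigenvalues i} := by
  let F : E →ₗ[ℝ] {i // t ≤ hA.eigenvalues i} → ℝ :=
    LinearMap.pi fun i => (dotProductBilin ℝ ℝ (hA.eigenvectorBasis i : V → ℝ)).comp T
  have hF : Function.Injective F := by
    rw [injective_iff_map_eq_zero]
    intro c hc
    have hle : ∀ i, hA.eigenvalues i * (hA.eigenvectorBasis i ⬝ᵥ T c) ^ 2
        ≤ t * (hA.eigenvectorBasis i ⬝ᵥ T c) ^ 2 := by
      intro i
      by_cases hi : t ≤ hA.eigenvalues i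
      · have : (hA.eigenvectorBasis i : V → ℝ) ⬝ᵥ T c = 0 := congrFun hc ⟨i, hi⟩
        simp [this]
      · exact mul_le_mul_of_nonneg_right (not_le.1 hi).le (sq_nonneg _)
    have h1 := h c
    rw [← hA.sum_eigenvalues_mul_inner_sq, ← hA.sum_inner_eigenvectorBasis_sq,
      Finset.mul_sum] at h1
    -- The summed inequality is an equality, hence so is each term. This kills the components with
    -- eigenvalue below `t` too.
    have h2 := (Finset.sum_eq_sum_iff_of_le fun i _ => hle i).1
      (le_antisymm (Finset.sum_le_sum fun i _ => hle i) h1)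
    have h3 : ∀ i, (hA.eigenvectorBasis i : V → ℝ) ⬝ᵥ T c = 0 := by
      intro i
      by_cases hi : t ≤ hA.eigenvalues i
      · exact congrFun hc ⟨i, hi⟩
      · by_contra h0
        exact hi (mul_right_cancel₀ (pow_ne_zero 2 h0) (h2 i (mem_univ i))).ge
    have h4 := hA.sum_inner_eigenvectorBasis_sq (T c)
    simp only [h3, ne_eq, OfNat.ofNat_ne_zero, not_false_eq_true, zero_pow, sum_const_zero] at h4
    exact hT (by rw [dotProduct_self_eq_zero.1 h4.symm, map_zero])
  have := LinearMap.finrank_le_finrank_of_injective hF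
  rwa [Module.finrank_fintype_fun_eq_card, Fintype.card_subtype] at this

lemma Matrix.IsHermitian.eigenvalues_le_of_dotProduct_mulVec_le {A : Matrix V V ℝ}
    (hA : A.IsHermitian) {t : ℝ} (h : ∀ x, x ⬝ᵥ A *ᵥ x ≤ t * (x ⬝ᵥ x)) (i : V) :
    hA.eigenvalues i ≤ t := by
  have h1 : (hA.eigenvectorBasis i : V → ℝ) ⬝ᵥ hA.eigenvectorBasis i = 1 := by
    have := hA.eigenvectorBasis.orthonormal.1 i
    rw [EuclideanSpace.norm_eq, Real.sqrt_eq_one] at this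
    rw [← this]
    simp [dotProduct, sq]
  have h2 := h (hA.eigenvectorBasis i)
  rwa [hA.mulVec_eigenvectorBasis, dotProduct_smul, h1, smul_eq_mul, mul_one, mul_one] at h2

end Spectral

/-! ### The Laplacian form of a graph and of its complement. -/

namespace SimpleGraph

section Energy

variable {V : Type*} [Fintype V] (G : SimpleGraph V) [DecidableRel G.Adj]

/-- Twice the Laplacian quadratic form: the sum over all ordered pairs of adjacent vertices of the
squared differences. -/
def energy (x : V → ℝ) : ℝ := ∑ i, ∑ j, if G.Adj i j then (x i - x j) ^ 2 else 0

lemma energy_nonneg (x : V → ℝ) : 0 ≤ G.energy x :=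
  sum_nonneg fun _ _ => sum_nonneg fun _ _ => by split_ifs <;> positivity

lemma energy_add_const (x : V → ℝ) (a : ℝ) : G.energy (fun i => x i + a) = G.energy x := by
  simp [energy]

end Energy

section Laplacian

variable {V : Type*} [Fintype V] [DecidableEq V] (G : SimpleGraph V) [DecidableRel G.Adj]

lemma dotProduct_lapMatrix_mulVec (x : V → ℝ) :
    x ⬝ᵥ G.lapMatrix ℝ *ᵥ x = G.energy x / 2 := by
  rw [energy, ← lapMatrix_toLinearMap₂', toLinearMap₂'_apply']

lemma energy_add_energy_compl (x : V → ℝ) :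
    G.energy x + Gᶜ.energy x = 2 * (Fintype.card V * (x ⬝ᵥ x) - (∑ i, x i) ^ 2) := by
  have h : ∀ i j, (if G.Adj i j then (x i - x j) ^ 2 else 0)
      + (if Gᶜ.Adj i j then (x i - x j) ^ 2 else 0) = (x i - x j) ^ 2 := by
    intro i j
    by_cases hij : i = j
    · subst hij; simp
    · by_cases hG : G.Adj i j <;> simp [hG, hij]
  simp only [energy, ← sum_add_distrib, h]
  simp only [sub_sq]
  simp only [sum_add_distrib, sum_sub_distrib, sum_const, card_univ, nsmul_eq_mul, ← mul_sum,
    ← sum_mul, dotProduct, ← sq]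
  ring

lemma dotProduct_lapMatrix_mulVec_eq_compl (x : V → ℝ) :
    x ⬝ᵥ G.lapMatrix ℝ *ᵥ x
      = Fintype.card V * (x ⬝ᵥ x) - (∑ i, x i) ^ 2 - Gᶜ.energy x / 2 := by
  rw [dotProduct_lapMatrix_mulVec]
  linarith [G.energy_add_energy_compl x]

end Laplacian

end SimpleGraph

/-! ### Reduction to the complement. -/

section LaplacianCount

variable {V : Type*} [Fintype V] [DecidableEq V] (G : SimpleGraph V) [DecidableRel G.Adj]

/-- The complement's form is nonnegative, so no eigenvalue exceeds `|V|` and the upper end of the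
interval imposes nothing. -/
lemma laplacianCount_eq {t : ℝ} :
    laplacianCount G (Set.Icc t (Fintype.card V))
      = #{i | t ≤ (SimpleGraph.posSemidef_lapMatrix ℝ G).isHermitian.eigenvalues i} := by
  rw [laplacianCount, ← Set.ncard_coe_finset]
  congr 1
  ext i
  simp only [Set.mem_Icc, Set.mem_ofPred_eq, coe_filter, mem_univ, true_and, and_iff_left_iff_imp]
  refine fun _ => Matrix.IsHermitian.eigenvalues_le_of_dotProduct_mulVec_le _ (fun x => ?_) i
  rw [G.dotProduct_lapMatrix_mulVec_eq_compl]
  linarith [Gᶜ.energy_nonneg x, sq_nonneg (∑ i, x i)]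

/-- If the complement has a linear family of vectors on which its Laplacian form exceeds `2`, then
`G` has at least one more eigenvalue below `|V| - 2` than the dimension of that family. -/
lemma laplacianCount_add_finrank_lt (hV : 2 < Fintype.card V) {E : Type*} [AddCommGroup E] [Module ℝ E]
    [Module.Finite ℝ E] (T : E →ₗ[ℝ] V → ℝ)
    (hT : ∀ c, c ≠ 0 → 4 * (T c ⬝ᵥ T c) < Gᶜ.energy (T c)) :
    laplacianCount G (Set.Icc ((Fintype.card V : ℝ) - 2) (Fintype.card V)) + Module.finrank ℝ E
      < Fintype.card V := by
  have hA := (SimpleGraph.posSemidef_lapMatrix ℝ G).isHermitian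
  obtain ⟨N, hN⟩ : ∃ N : ℝ, N = Fintype.card V := ⟨_, rfl⟩
  have hN2 : 2 < N := by rw [hN]; exact_mod_cast hV
  let μ : (V → ℝ) →ₗ[ℝ] ℝ := N⁻¹ • ∑ i, LinearMap.proj i
  have hμ : ∀ x : V → ℝ, N * μ x = ∑ i, x i := by
    intro x
    simp only [μ, LinearMap.smul_apply, LinearMap.sum_apply, LinearMap.proj_apply, smul_eq_mul]
    field_simp
  -- `S (a, c)` is `T c` shifted to have mean `a`. The shift preserves the complement's energy, and
  -- centring does not increase the norm; the parameter `a` adds the constant vectors, which supply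
  -- the extra eigenvalue.
  let S : ℝ × E →ₗ[ℝ] V → ℝ :=
    LinearMap.pi fun i => LinearMap.coprod LinearMap.id
      ((LinearMap.proj i - μ).comp T)
  have hS : ∀ a c i, S (a, c) i = T c i + (a - μ (T c)) := by
    intro a c i
    simp [S]; ring
  have hsq : ∀ a c, S (a, c) ⬝ᵥ S (a, c) = T c ⬝ᵥ T c - N * μ (T c) ^ 2 + N * a ^ 2 := by
    intro a c
    have h1 : ∀ i, S (a, c) i * S (a, c) i
        = T c i * T c i + 2 * (a - μ (T c)) * T c i + (a - μ (T c)) ^ 2 := by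
      intro i; rw [hS]; ring
    simp only [dotProduct, h1, sum_add_distrib, ← mul_sum, sum_const, card_univ,
      nsmul_eq_mul, ← hN]
    rw [← hμ (T c)]
    ring
  have hsum : ∀ a c, ∑ i, S (a, c) i = N * a := by
    intro a c
    simp only [hS, sum_add_distrib, sum_const, card_univ, nsmul_eq_mul, ← hN]
    rw [← hμ (T c)]
    ring
  have hen : ∀ a c, Gᶜ.energy (S (a, c)) = Gᶜ.energy (T c) := by
    intro a c
    rw [← Gᶜ.energy_add_const (T c) (a - μ (T c))]
    congr 1
    exact funext (hS a c)
  have key := hA.finrank_le_card_eigenvalues_lt S (N - 2) (by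
    rintro ⟨a, c⟩ h0
    rw [G.dotProduct_lapMatrix_mulVec_eq_compl, hsum, hsq, hen, ← hN]
    have hμ0 : 0 ≤ N * μ (T c) ^ 2 := by positivity
    by_cases hc : c = 0
    · subst hc
      have ha : a ≠ 0 := by rintro rfl; exact h0 rfl
      have h1 : 0 < N * (N - 2) * a ^ 2 :=
        mul_pos (mul_pos (by linarith) (by linarith)) (by positivity)
      have h2 : 0 ≤ Gᶜ.energy (T 0) := Gᶜ.energy_nonneg _
      simp only [map_zero, dotProduct_zero] at hμ0 h2 ⊢
      linarith
    · have h1 : 0 ≤ N * (N - 2) * a ^ 2 :=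
        mul_nonneg (mul_nonneg (by linarith) (by linarith)) (sq_nonneg a)
      linarith [hT c hc])
  rw [Module.finrank_prod, Module.finrank_self, hN] at key
  rw [laplacianCount_eq]
  have hsplit := card_filter_add_card_filter_not (s := (univ : Finset V))
    (fun i => (Fintype.card V : ℝ) - 2 ≤ hA.eigenvalues i)
  simp only [not_le, card_univ] at hsplit
  omega

/-- If all vertices other than `x` and `y` are pairwise adjacent, then at most three eigenvalues
are less than `|V| - 2`. -/
lemma card_sub_three_le_laplacianCount {x y : V}
    (h : ∀ i j, i ≠ x → i ≠ y → j ≠ x → j ≠ y → i ≠ j → G.Adj i j) :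
    Fintype.card V - 3
      ≤ laplacianCount G (Set.Icc ((Fintype.card V : ℝ) - 2) (Fintype.card V)) := by
  have hA := (SimpleGraph.posSemidef_lapMatrix ℝ G).isHermitian
  -- The test space consists of the vectors of sum zero that vanish at `x` and `y`.
  let φ : (V → ℝ) →ₗ[ℝ] Fin 3 → ℝ :=
    LinearMap.pi ![LinearMap.proj x, LinearMap.proj y, ∑ i, LinearMap.proj i]
  rw [laplacianCount_eq]
  have hdim : Fintype.card V - 3 ≤ Module.finrank ℝ (LinearMap.ker φ) := by
    have h1 := φ.finrank_range_add_finrank_ker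
    have h2 := (LinearMap.range φ).finrank_le
    simp only [Module.finrank_fintype_fun_eq_card, Fintype.card_fin] at h1 h2
    omega
  refine hdim.trans (hA.finrank_le_card_le_eigenvalues (LinearMap.ker φ).subtype
    (Submodule.injective_subtype _) _ ?_)
  rintro ⟨c, hc⟩
  rw [LinearMap.mem_ker] at hc
  have hx : c x = 0 := congrFun hc 0
  have hy : c y = 0 := congrFun hc 1
  have hs : ∑ i, c i = 0 := by simpa [φ] using congrFun hc 2
  rw [G.dotProduct_lapMatrix_mulVec_eq_compl, Submodule.subtype_apply, hs]
  -- Every edge of the complement has an end at `x` or `y`, where `c` is zero, so it costs the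
  -- square at its other end. Each vertex pays at most once for `x` and once for `y`, in both
  -- orders, whence the factor 4 below.
  have hterm : ∀ i j, (if Gᶜ.Adj i j then (c i - c j) ^ 2 else 0)
      ≤ (if i = x then c j ^ 2 else 0) + (if i = y then c j ^ 2 else 0)
        + ((if j = x then c i ^ 2 else 0) + (if j = y then c i ^ 2 else 0)) := by
    intro i j
    have h0 : ∀ (p : Prop) [Decidable p] (r : ℝ), 0 ≤ if p then r ^ 2 else 0 := by
      intro p _ r; split_ifs <;> positivity
    have e1 := h0 (i = x) (c j)
    have e2 := h0 (i = y) (c j)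
    have e3 := h0 (j = x) (c i)
    have e4 := h0 (j = y) (c i)
    by_cases hij : Gᶜ.Adj i j
    · rw [if_pos hij]
      rw [SimpleGraph.compl_adj] at hij
      by_cases h1 : i = x
      · rw [if_pos h1, show c i - c j = -c j by rw [show c i = 0 from h1 ▸ hx]; ring, neg_sq]; linarith
      by_cases h2 : i = y
      · rw [if_pos h2, show c i - c j = -c j by rw [show c i = 0 from h2 ▸ hy]; ring, neg_sq]; linarith
      by_cases h3 : j = x
      · rw [if_pos h3, show c i - c j = c i by rw [show c j = 0 from h3 ▸ hx]; ring]; linarith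
      by_cases h4 : j = y
      · rw [if_pos h4, show c i - c j = c i by rw [show c j = 0 from h4 ▸ hy]; ring]; linarith
      exact absurd (h i j h1 h2 h3 h4 hij.1) hij.2
    · rw [if_neg hij]; linarith
  have hen : Gᶜ.energy c ≤ 4 * (c ⬝ᵥ c) := by
    refine (sum_le_sum fun i _ => sum_le_sum fun j _ => hterm i j).trans_eq ?_
    simp only [sum_add_distrib, sum_ite_eq', mem_univ, if_true, dotProduct, ← sq]
    rw [sum_comm, sum_comm (f := fun i j => if i = y then c j ^ 2 else 0)]
    simp only [sum_ite_eq', mem_univ, if_true]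
    ring
  linarith

end LaplacianCount

/-! ### Small subgraphs of the complement with many eigenvalues above 2. -/

section Subgraph

variable {V : Type*} [Fintype V] [DecidableEq V] (G : SimpleGraph V) [DecidableRel G.Adj]

/-- Extending by zero only adds nonnegative terms, from edges outside the chosen subgraph. -/
lemma SimpleGraph.sum_le_energy_extend {k : ℕ} (f : Fin k → V) (hf : Function.Injective f)
    (F : Fin k → Fin k → Prop) [∀ i j, Decidable (F i j)]
    (hF : ∀ i j, F i j → G.Adj (f i) (f j)) (y : Fin k → ℝ) :
    (∑ i, ∑ j, if F i j then (y i - y j) ^ 2 else 0) ≤ G.energy (Function.extend f y 0) := by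
  set g : V → V → ℝ := fun i j =>
    if G.Adj i j then (Function.extend f y 0 i - Function.extend f y 0 j) ^ 2 else 0 with hg
  have hg0 : ∀ i j, 0 ≤ g i j := by
    intro i j; simp only [hg]; split_ifs <;> positivity
  have hsum : ∀ h : V → ℝ, (∀ i, 0 ≤ h i) → ∑ i, h (f i) ≤ ∑ i, h i := by
    intro h hh
    rw [← sum_image (f := h) (s := univ) (g := f) hf.injOn]
    exact sum_le_sum_of_subset_of_nonneg (subset_univ _) fun i _ _ => hh i
  calc (∑ i, ∑ j, if F i j then (y i - y j) ^ 2 else 0)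
      ≤ ∑ i, ∑ j, g (f i) (f j) := by
        refine sum_le_sum fun i _ => sum_le_sum fun j _ => ?_
        split_ifs with h
        · simp only [hg, if_pos (hF i j h), hf.extend_apply, le_refl]
        · exact hg0 _ _
    _ ≤ ∑ i, ∑ j, g (f i) j := sum_le_sum fun i _ => hsum _ fun j => hg0 _ _
    _ ≤ ∑ i, ∑ j, g i j := hsum (fun i => ∑ j, g i j) fun i => sum_nonneg fun j _ => hg0 i j

lemma dotProduct_extend_self {k : ℕ} (f : Fin k → V) (hf : Function.Injective f)
    (y : Fin k → ℝ) :
    Function.extend f y 0 ⬝ᵥ Function.extend f y 0 = ∑ i, y i ^ 2 := by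
  have h : ∑ i, Function.extend f y 0 (f i) * Function.extend f y 0 (f i)
      = ∑ i, Function.extend f y 0 i * Function.extend f y 0 i := by
    rw [← sum_image (f := fun i => Function.extend f y 0 i * Function.extend f y 0 i)
      (s := univ) (g := f) hf.injOn]
    refine sum_subset (subset_univ _) fun i _ hi => ?_
    rw [Function.extend_apply' _ _ _ (by simpa using hi)]
    simp
  rw [dotProduct, ← h]
  simp only [hf.extend_apply, sq]

/-- The edges listed in `l`, read as an unordered relation. -/
abbrev listRel {k : ℕ} (l : List (Fin k × Fin k)) (i j : Fin k) : Prop := (i, j) ∈ l ∨ (j, i) ∈ l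

/-- A subgraph of the complement on `k` vertices whose Laplacian form exceeds `2` on the range of
an `r × k` matrix forces `r + 1` eigenvalues of `G` below `|V| - 2`. -/
lemma laplacianCount_add_lt_of_compl_edges (hV : 2 < Fintype.card V) {k r : ℕ} (f : Fin k → V)
    (hf : Function.Injective f) (l : List (Fin k × Fin k))
    (hl : ∀ e ∈ l, Gᶜ.Adj (f e.1) (f e.2)) (M : Matrix (Fin r) (Fin k) ℝ)
    (hM : ∀ c : Fin r → ℝ, c ≠ 0 → 4 * ∑ i, (c ᵥ* M) i ^ 2
      < ∑ i, ∑ j, if listRel l i j then ((c ᵥ* M) i - (c ᵥ* M) j) ^ 2 else 0) :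
    laplacianCount G (Set.Icc ((Fintype.card V : ℝ) - 2) (Fintype.card V)) + r
      < Fintype.card V := by
  have h := laplacianCount_add_finrank_lt G hV
    ((Function.ExtendByZero.linearMap ℝ f).comp M.vecMulLinear) (by
      intro c hc
      change 4 * (Function.extend f (c ᵥ* M) 0 ⬝ᵥ Function.extend f (c ᵥ* M) 0)
        < Gᶜ.energy (Function.extend f (c ᵥ* M) 0)
      rw [dotProduct_extend_self f hf]
      refine (hM c hc).trans_le (Gᶜ.sum_le_energy_extend f hf _ ?_ _)
      rintro i j (h | h)
      · exact hl _ h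
      · exact (hl _ h).symm)
  simpa using h

lemma sum_sq_pos {r : ℕ} {c : Fin r → ℝ} (hc : c ≠ 0) : 0 < ∑ i, c i ^ 2 := by
  obtain ⟨i, hi⟩ := Function.ne_iff.1 hc
  exact sum_pos' (fun _ _ => sq_nonneg _) ⟨i, mem_univ _, by have : c i ≠ 0 := hi; positivity⟩

/-- The complement contains a tree on five vertices with degree sequence `3, 2, 1, 1, 1`. -/
lemma laplacianCount_add_two_lt (hV : 2 < Fintype.card V) {u v a b c : V}
    (hf : Function.Injective ![u, v, a, b, c]) (huv : Gᶜ.Adj u v) (hva : Gᶜ.Adj v a)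
    (hub : Gᶜ.Adj u b) (huc : Gᶜ.Adj u c) :
    laplacianCount G (Set.Icc ((Fintype.card V : ℝ) - 2) (Fintype.card V)) + 2
      < Fintype.card V := by
  refine laplacianCount_add_lt_of_compl_edges G hV _ hf [(0, 1), (1, 2), (0, 3), (0, 4)]
    (by simp [-SimpleGraph.compl_adj, huv, hva, hub, huc])
    -- The rows put opposite signs on a centre and its leaves: `u` against `b, c`, and `v` against
    -- `a`.
    !![1, 0, 0, -1, -1; 0, 1, -1, 0, 0] fun c hc => ?_
  have h := sum_sq_pos hc
  simp [Fin.sum_univ_succ, Matrix.vecMul, dotProduct, listRel] at h ⊢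
  linarith [sq_nonneg (c 0), sq_nonneg (c 1), sq_nonneg (2 * c 0 - c 1)]

/-- The complement contains a triangle with a pendant path of length two. -/
lemma laplacianCount_add_three_lt_of_lollipop (hV : 2 < Fintype.card V) {u x y v a : V}
    (hf : Function.Injective ![u, x, y, v, a]) (hux : Gᶜ.Adj u x) (huy : Gᶜ.Adj u y)
    (hxy : Gᶜ.Adj x y) (huv : Gᶜ.Adj u v) (hva : Gᶜ.Adj v a) :
    laplacianCount G (Set.Icc ((Fintype.card V : ℝ) - 2) (Fintype.card V)) + 3
      < Fintype.card V := by
  refine laplacianCount_add_lt_of_compl_edges G hV _ hf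
    [(0, 1), (0, 2), (1, 2), (0, 3), (3, 4)]
    (by simp [-SimpleGraph.compl_adj, hux, huy, hxy, huv, hva])
    -- The graph is the previous tree with its leaves at `u` joined. The first two rows are those of
    -- the tree; the third is an eigenvector for 3.
    !![1, -1, -1, 0, 0; 0, 0, 0, 1, -1; 0, 1, -1, 0, 0] fun c hc => ?_
  have h := sum_sq_pos hc
  simp [Fin.sum_univ_succ, Matrix.vecMul, dotProduct, listRel] at h ⊢
  linarith [sq_nonneg (c 0), sq_nonneg (c 1), sq_nonneg (c 2), sq_nonneg (2 * c 0 - c 1)]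

/-- The complement contains a cycle of length four with pendant vertices at two adjacent
vertices. -/
lemma laplacianCount_add_three_lt_of_cycle_pendants (hV : 2 < Fintype.card V) {u v x y b a : V}
    (hf : Function.Injective ![u, v, x, y, b, a]) (huv : Gᶜ.Adj u v) (hux : Gᶜ.Adj u x)
    (hvy : Gᶜ.Adj v y) (hxy : Gᶜ.Adj x y) (hub : Gᶜ.Adj u b) (hva : Gᶜ.Adj v a) :
    laplacianCount G (Set.Icc ((Fintype.card V : ℝ) - 2) (Fintype.card V)) + 3
      < Fintype.card V := by
  refine laplacianCount_add_lt_of_compl_edges G hV _ hf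
    [(0, 1), (0, 2), (1, 3), (2, 3), (0, 4), (1, 5)]
    (by simp [-SimpleGraph.compl_adj, huv, hux, hvy, hxy, hub, hva])
    -- Under the symmetry exchanging `u, x, b` with `v, y, a`, the first row is even and the other
    -- two are odd.
    !![1, 1, -1, -1, -1, -1; 1, -1, 0, 0, -1, 1; 0, 0, 1, -1, 0, 0] fun c hc => ?_
  have h := sum_sq_pos hc
  simp [Fin.sum_univ_succ, Matrix.vecMul, dotProduct, listRel] at h ⊢
  linarith [sq_nonneg (c 0), sq_nonneg (c 1), sq_nonneg (c 2), sq_nonneg (2 * c 1 - c 2)]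

end Subgraph

/-! ### Geodesics of length three and graphs complete off two vertices. -/

namespace SimpleGraph

variable {V : Type*} {G : SimpleGraph V}

/-- `u, a, b, v` are the successive vertices of a path of length three between vertices `u` and `v`
at distance three. -/
structure IsGeodesicThree (G : SimpleGraph V) (u a b v : V) : Prop where
  ne : u ≠ v
  not_adj : ¬ G.Adj u v
  not_adj_of_adj : ∀ w, G.Adj u w → ¬ G.Adj v w
  adj_ua : G.Adj u a
  adj_ab : G.Adj a b
  adj_vb : G.Adj v b

/-- The vertices of `G` other than `x` and `y` are pairwise adjacent. -/
def IsCliqueOff (G : SimpleGraph V) (x y : V) : Prop :=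
  ∀ i j, i ≠ x → i ≠ y → j ≠ x → j ≠ y → i ≠ j → G.Adj i j

lemma IsCliqueOff.of_iso {W : Type*} {K : SimpleGraph W} (e : G ≃g K) {x y : W}
    (h : K.IsCliqueOff x y) : G.IsCliqueOff (e.symm x) (e.symm y) := by
  intro i j hix hiy hjx hjy hij
  rw [← e.map_adj_iff]
  have key : ∀ i z, i ≠ e.symm z → e i ≠ z := by
    rintro i z hi rfl
    exact hi (e.symm_apply_apply i).symm
  exact h _ _ (key _ _ hix) (key _ _ hiy) (key _ _ hjx) (key _ _ hjy) (e.injective.ne hij)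

lemma IsCliqueOff.symm {x y : V} (h : G.IsCliqueOff x y) : G.IsCliqueOff y x :=
  fun i j hix hiy hjx hjy => h i j hiy hix hjy hjx

namespace IsGeodesicThree

variable {u a b v : V}

lemma symm (h : G.IsGeodesicThree u a b v) : G.IsGeodesicThree v b a u where
  ne := h.ne.symm
  not_adj := fun h' => h.not_adj h'.symm
  not_adj_of_adj := fun w hv hu => h.not_adj_of_adj w hu hv
  adj_ua := h.adj_vb
  adj_ab := h.adj_ab.symm
  adj_vb := h.adj_ua

lemma not_adj_va (h : G.IsGeodesicThree u a b v) : ¬ G.Adj v a := h.not_adj_of_adj a h.adj_ua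

lemma not_adj_ub (h : G.IsGeodesicThree u a b v) : ¬ G.Adj u b := h.symm.not_adj_va

lemma nodup (h : G.IsGeodesicThree u a b v) : [u, a, b, v].Nodup := by
  have h1 := h.adj_ua.ne
  have h2 := h.adj_ab.ne
  have h3 := h.adj_vb.ne
  have h4 : u ≠ b := by rintro rfl; exact h.not_adj h.adj_vb.symm
  have h5 : v ≠ a := by rintro rfl; exact h.not_adj h.adj_ua
  simp [h1, h2, h3.symm, h4, h5.symm, h.ne]

lemma injective (h : G.IsGeodesicThree u a b v) : Function.Injective ![u, a, b, v] :=
  List.nodup_ofFn.1 (by simpa using h.nodup)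

lemma adj_iff (h : G.IsGeodesicThree u a b v) (i j : Fin 4) :
    G.Adj (![u, a, b, v] i) (![u, a, b, v] j) ↔ (i : ℕ) + 1 = j ∨ (j : ℕ) + 1 = i := by
  have h1 := h.adj_ua
  have h2 := h.adj_ab
  have h3 := h.adj_vb
  have h4 := h.not_adj
  have h5 := h.not_adj_ub
  have h6 := h.not_adj_va
  have h1' := h1.symm
  have h2' := h2.symm
  have h3' := h3.symm
  have h4' := h.symm.not_adj
  have h5' : ¬ G.Adj b u := fun h' => h5 h'.symm
  have h6' : ¬ G.Adj a v := fun h' => h6 h'.symm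
  fin_cases i <;> fin_cases j <;> simp [*]

lemma ne_of_notMem_image [DecidableEq V] {w : V} (hw : w ∉ univ.image ![u, a, b, v]) :
    w ≠ u ∧ w ≠ a ∧ w ≠ b ∧ w ≠ v := by
  simp [Fin.exists_fin_succ, eq_comm] at hw
  grind

end IsGeodesicThree

lemma exists_isGeodesicThree (hd : G.ediam = 3) : ∃ u a b v, G.IsGeodesicThree u a b v := by
  have hne : Nontrivial V := nontrivial_of_ediam_ne_zero (by rw [hd]; decide)
  obtain ⟨u, v, huv⟩ := exists_edist_eq_ediam_of_ne_top (G := G) (by rw [hd]; decide)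
  rw [hd] at huv
  have hle : ∀ p : G.Walk u v, 3 ≤ p.length := by
    intro p
    have := huv ▸ edist_le p
    exact_mod_cast this
  obtain ⟨p, hp⟩ := exists_walk_of_edist_eq_coe (k := 3) huv
  match p, hp with
  | .cons h1 (.cons h2 (.cons h3 .nil)), _ =>
    refine ⟨u, _, _, v, ⟨?_, ?_, ?_, h1, h2, h3.symm⟩⟩
    · rintro rfl
      exact absurd (hle .nil) (by simp)
    · intro h
      exact absurd (hle (.cons h .nil)) (by simp)
    · intro w hu hv
      exact absurd (hle (.cons hu (.cons hv.symm .nil))) (by simp)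

end SimpleGraph

lemma injective_of_nodup_ofFn {V : Type*} {k : ℕ} {f : Fin k → V} (h : (List.ofFn f).Nodup) :
    Function.Injective f := List.nodup_ofFn.1 h

/-! ### The structure forced by equality. -/

section Forbidden

open SimpleGraph

variable {V : Type*} [Fintype V] [DecidableEq V] {G : SimpleGraph V} [DecidableRel G.Adj]
  {u a b v : V}

lemma SimpleGraph.IsGeodesicThree.laplacianCount_add_two_lt (h : G.IsGeodesicThree u a b v)
    (hV : 5 ≤ Fintype.card V) :
    laplacianCount G (Set.Icc ((Fintype.card V : ℝ) - 2) (Fintype.card V)) + 2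
      < Fintype.card V := by
  have hnd := h.nodup
  have hub := h.not_adj_ub
  have hva := h.not_adj_va
  obtain ⟨c, hc⟩ : ∃ c, c ∉ [u, a, b, v].toFinset := by
    by_contra! hcon
    have h1 := List.toFinset_card_le [u, a, b, v]
    rw [Finset.eq_univ_of_forall hcon, card_univ] at h1
    simp at h1
    omega
  simp at hc hnd
  have h1 := h.ne
  have h2 := h.not_adj
  by_cases hcu : G.Adj u c
  · have hcv := h.not_adj_of_adj c hcu
    refine _root_.laplacianCount_add_two_lt G (by omega) (u := v) (v := u) (a := b) (b := a)
      (c := c) (injective_of_nodup_ofFn ?_) ?_ ?_ ?_ ?_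
    · simp; grind
    all_goals rw [compl_adj]; grind [SimpleGraph.adj_comm]
  · refine _root_.laplacianCount_add_two_lt G (by omega) (u := u) (v := v) (a := a) (b := b)
      (c := c) (injective_of_nodup_ofFn ?_) ?_ ?_ ?_ ?_
    · simp; grind
    all_goals rw [compl_adj]; grind

/-- Otherwise `u, x, y` is a triangle of the complement with tail `u - v - a`; `a` lies off it
because `u` is adjacent to `a` in `G`. -/
lemma SimpleGraph.IsGeodesicThree.adj_or_adj (h : G.IsGeodesicThree u a b v)
    (hV : 5 ≤ Fintype.card V)
    (hc : Fintype.card V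
      ≤ laplacianCount G (Set.Icc ((Fintype.card V : ℝ) - 2) (Fintype.card V)) + 3)
    {x y : V} (hxu : x ≠ u) (hxv : x ≠ v) (hyu : y ≠ u) (hyv : y ≠ v) (hxy : x ≠ y)
    (hG : ¬ G.Adj x y) : G.Adj u x ∨ G.Adj u y := by
  by_contra! hcon
  have hnd := h.nodup
  have hva := h.not_adj_va
  have hua := h.adj_ua
  have huv := h.not_adj
  simp at hnd
  refine hc.not_gt (laplacianCount_add_three_lt_of_lollipop G (by omega) (u := u) (x := x)
    (y := y) (v := v) (a := a) (injective_of_nodup_ofFn ?_) ?_ ?_ ?_ ?_ ?_)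
  · simp; grind
  all_goals rw [compl_adj]; grind

lemma SimpleGraph.IsGeodesicThree.false_of_cycle (h : G.IsGeodesicThree u a b v)
    (hV : 5 ≤ Fintype.card V)
    (hc : Fintype.card V
      ≤ laplacianCount G (Set.Icc ((Fintype.card V : ℝ) - 2) (Fintype.card V)) + 3)
    {x y x' y' : V} (hnd : [u, v, x, y, x', y'].Nodup)
    (hux : ¬ G.Adj u x) (hvy : ¬ G.Adj v y) (hxy : ¬ G.Adj x y) (hux' : ¬ G.Adj u x')
    (hvy' : ¬ G.Adj v y') : False := by
  have huv := h.not_adj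
  simp at hnd
  refine hc.not_gt (laplacianCount_add_three_lt_of_cycle_pendants G (by omega) (u := u) (v := v)
    (x := x) (y := y) (b := x') (a := y') (injective_of_nodup_ofFn ?_) ?_ ?_ ?_ ?_ ?_ ?_)
  · simp; grind
  all_goals rw [compl_adj]; grind

/-- The complement contains the 4-cycle `u, v, a, x` with pendant `b` at `u`, so `v` can have no
pendant: in `G` it is adjacent to everything but `u` and `a`. Then `u` has no neighbour except `a`,
and `adj_or_adj` leaves no other non-adjacent pair. -/
lemma SimpleGraph.IsGeodesicThree.isCliqueOff_of_not_adj (h : G.IsGeodesicThree u a b v)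
    (hV : 5 ≤ Fintype.card V)
    (hc : Fintype.card V
      ≤ laplacianCount G (Set.Icc ((Fintype.card V : ℝ) - 2) (Fintype.card V)) + 3)
    {x : V} (hxu : x ≠ u) (hxv : x ≠ v) (hxb : x ≠ b) (hux : ¬ G.Adj u x) (hvx : G.Adj v x)
    (hxa : ¬ G.Adj x a) : G.IsCliqueOff u a := by
  have hnd := h.nodup
  have hva := h.not_adj_va
  have hua := h.adj_ua
  have hub := h.not_adj_ub
  have hvb := h.adj_vb
  have huv := h.not_adj
  simp at hnd
  have hv : ∀ j, j ≠ u → j ≠ a → j ≠ v → G.Adj v j := by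
    intro j hju hja hjv
    by_contra hj
    exact h.false_of_cycle hV hc (x := x) (y := a) (x' := b) (y' := j) (by simp; grind)
      hux hva hxa hub hj
  intro i j hiu hia hju hja hij
  by_cases hiv : i = v
  · subst hiv
    exact hv j hju hja hij.symm
  by_cases hjv : j = v
  · subst hjv
    exact (hv i hiu hia hij).symm
  by_contra hG
  have h1 := h.adj_or_adj hV hc hiu hiv hju hjv hij hG
  have h2 := hv i hiu hia hiv
  have h3 := hv j hju hja hjv
  rcases h1 with h1 | h1
  · exact h.not_adj_of_adj _ h1 h2
  · exact h.not_adj_of_adj _ h1 h3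

lemma SimpleGraph.IsGeodesicThree.isCliqueOff_or (h : G.IsGeodesicThree u a b v)
    (hV : 5 ≤ Fintype.card V)
    (hc : Fintype.card V
      ≤ laplacianCount G (Set.Icc ((Fintype.card V : ℝ) - 2) (Fintype.card V)) + 3) :
    G.IsCliqueOff u v ∨ G.IsCliqueOff u a ∨ G.IsCliqueOff v b := by
  by_contra! hcon
  obtain ⟨h0, h1, h2⟩ := hcon
  have hua := h.adj_ua
  have hvb := h.adj_vb
  have hnd := h.nodup
  simp at hnd
  -- A failure yields the complement cycle `u, v, y, x` with pendants `b` and `a`. If `x = b` or `y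
  -- = a` these coincide with cycle vertices, and `isCliqueOff_of_not_adj` applies instead.
  have main : ∀ x y, x ≠ u → x ≠ v → y ≠ u → y ≠ v → x ≠ y → G.Adj v x → G.Adj u y →
      G.Adj x y := by
    intro x y hxu hxv hyu hyv hxy hvx huy
    by_contra hG
    have hvy := h.not_adj_of_adj y huy
    have hux := h.symm.not_adj_of_adj x hvx
    by_cases hxb : x = b
    · subst hxb
      have hya : y ≠ a := by rintro rfl; exact hG h.adj_ab.symm
      exact h2 (h.symm.isCliqueOff_of_not_adj hV hc hyv hyu hya hvy huy fun h' => hG h'.symm)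
    by_cases hya : y = a
    · subst hya
      exact h1 (h.isCliqueOff_of_not_adj hV hc hxu hxv hxb hux hvx hG)
    have hub := h.not_adj_ub
    have hva := h.not_adj_va
    exact h.false_of_cycle hV hc (x := x) (y := y) (x' := b) (y' := a) (by simp; grind)
      hux hvy hG hub hva
  refine h0 fun x y hxu hxv hyu hyv hxy => ?_
  by_contra hG
  -- One of `x, y` is adjacent to `u` and one to `v`; they differ, since `u` and `v` have no common
  -- neighbour, so `main` applies in one of the two orders.
  have e1 := h.adj_or_adj hV hc hxu hxv hyu hyv hxy hG
  have e2 := h.symm.adj_or_adj hV hc hxv hxu hyv hyu hxy hG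
  have e3 := h.not_adj_of_adj x
  have e4 := h.not_adj_of_adj y
  have m1 := main x y hxu hxv hyu hyv hxy
  have m2 := main y x hyu hyv hxu hxv hxy.symm
  have := G.adj_comm x y
  tauto

end Forbidden

/-! ### Isomorphisms from class sizes. -/

lemma Fin.card_filter_le_and_lt {m : ℕ} (a b : ℕ) (hb : b ≤ m) :
    #{j : Fin m | a ≤ (j : ℕ) ∧ (j : ℕ) < b} = b - a := by
  rw [← Nat.card_Ico, ← Finset.card_map Fin.valEmbedding]
  congr 1
  ext j
  simp only [mem_map, mem_filter, mem_univ, true_and, Fin.valEmbedding_apply, mem_Ico]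
  constructor
  · rintro ⟨i, hi, rfl⟩
    exact hi
  · exact fun hj => ⟨⟨j, hj.2.trans_le hb⟩, hj, rfl⟩

section Iso

open SimpleGraph

variable {V : Type*} [Fintype V] [DecidableEq V] {G : SimpleGraph V}

/-- An isomorphism is found by matching the four special vertices, and the remaining ones according
to the colour classes of `cls` and `cls'`, whose sizes have to agree. -/
lemma nonempty_iso_of_card_classes {m : ℕ} {K : SimpleGraph (Fin 4 ⊕ Fin m)} (p : Fin 4 → V)
    (hp : Function.Injective p) (hm : Fintype.card V = 4 + m) (cls : V → Fin 3)
    (cls' : Fin m → Fin 3)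
    (h0 : #{w | w ∉ univ.image p ∧ cls w = 0} = #{j | cls' j = 0})
    (h1 : #{w | w ∉ univ.image p ∧ cls w = 1} = #{j | cls' j = 1})
    (hpp : ∀ i j, G.Adj (p i) (p j) ↔ K.Adj (Sum.inl i) (Sum.inl j))
    (hpc : ∀ i w j, w ∉ univ.image p → cls w = cls' j →
      (G.Adj (p i) w ↔ K.Adj (Sum.inl i) (Sum.inr j)))
    (hG : ∀ w w', w ∉ univ.image p → w' ∉ univ.image p → w ≠ w' → G.Adj w w')
    (hK : ∀ i j, i ≠ j → K.Adj (Sum.inr i) (Sum.inr j)) : Nonempty (G ≃g K) := by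
  -- The third class size follows from the other two, as both totals are `m`.
  have h2 : #{w | w ∉ univ.image p ∧ cls w = 2} = #{j | cls' j = 2} := by
    have e1 := card_eq_sum_card_fiberwise (f := cls) (s := (univ.image p)ᶜ) (t := univ)
      (by simp)
    have e2 := card_eq_sum_card_fiberwise (f := cls') (s := univ) (t := univ) (by simp)
    have e3 : ∀ c, #{w ∈ (univ.image p)ᶜ | cls w = c} = #{w | w ∉ univ.image p ∧ cls w = c} := by
      intro c; congr 1; ext w; simp
    rw [card_compl, card_image_of_injective _ hp] at e1
    simp only [Fin.sum_univ_three, e3, h0, h1, card_univ, Fintype.card_fin] at e1 e2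
    omega
  have hcard : ∀ c, #{w | w ∉ univ.image p ∧ cls w = c} = #{j | cls' j = c} := by
    intro c
    fin_cases c
    exacts [h0, h1, h2]
  have e : ∀ c, Nonempty ({w : {w // w ∉ univ.image p} // cls w = c} ≃ {j // cls' j = c}) := by
    intro c
    refine Fintype.card_eq.1 ?_
    rw [Fintype.card_congr (Equiv.subtypeSubtypeEquivSubtypeInter (fun w => w ∉ univ.image p)
      (fun w => cls w = c)), Fintype.card_subtype, Fintype.card_subtype]
    exact hcard c
  let E : {w // w ∉ univ.image p} ≃ Fin m :=
    Equiv.ofFiberEquiv (f := fun w : {w // w ∉ univ.image p} => cls w) (g := cls')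
      fun c => (e c).some
  have hE : ∀ j, cls (E.symm j) = cls' j := by
    intro j
    have := Equiv.ofFiberEquiv_map (f := fun w : {w // w ∉ univ.image p} => cls w) (g := cls')
      (fun c => (e c).some) (E.symm j)
    rw [← this]
    exact congrArg cls' (E.apply_symm_apply j)
  let g : Fin 4 ⊕ Fin m → V := Sum.elim p fun j => (E.symm j : V)
  have hg : Function.Injective g := by
    refine Function.Injective.sumElim hp (Subtype.val_injective.comp E.symm.injective) ?_
    intro i j hij
    exact (E.symm j).2 (hij ▸ mem_image_of_mem p (mem_univ i))
  have hg' : Function.Bijective g := by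
    rw [Fintype.bijective_iff_injective_and_card]
    exact ⟨hg, by simp [hm]⟩
  refine ⟨(RelIso.symm ⟨Equiv.ofBijective g hg', ?_⟩ : G ≃g K)⟩
  have hmix : ∀ i j, G.Adj (p i) (E.symm j) ↔ K.Adj (Sum.inl i) (Sum.inr j) :=
    fun i j => hpc i _ j (E.symm j).2 (hE j)
  rintro (i | i) (j | j)
  · exact hpp i j
  · exact hmix i j
  · exact (G.adj_comm _ _).trans ((hmix j i).trans (K.adj_comm _ _))
  · change G.Adj (E.symm i) (E.symm j) ↔ _
    by_cases hij : i = j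
    · subst hij
      simp
    · refine iff_of_true (hG _ _ (E.symm i).2 (E.symm j).2 fun h => hij ?_) (hK i j hij)
      exact E.symm.injective (Subtype.ext h)

end Iso

/-! ### Adjacency in the extremal families. -/

section Families

lemma graphN3_adj_inl_inl {n : ℕ} {i j : Fin 4} :
    (graphN3 n).Adj (Sum.inl i) (Sum.inl j) ↔ (i : ℕ) + 1 = j ∨ (j : ℕ) + 1 = i :=
  SimpleGraph.pathGraph_adj

lemma graphN3_adj_inl_inr {n : ℕ} {i : Fin 4} {j : Fin (n - 4)} :
    (graphN3 n).Adj (Sum.inl i) (Sum.inr j) ↔ i ≠ 0 := by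
  change ((i : ℕ) + 1 = 3 - 1 ∨ (i : ℕ) + 1 = 3 ∨ (i : ℕ) + 1 = 3 + 1) ↔ _
  fin_cases i <;> simp

lemma graphN3_adj_inr_inr {n : ℕ} {i j : Fin (n - 4)} :
    (graphN3 n).Adj (Sum.inr i) (Sum.inr j) ↔ i ≠ j := Iff.rfl

lemma graphN3Two_adj_inl_inl {n s : ℕ} {i j : Fin 4} :
    (graphN3Two n s).Adj (Sum.inl i) (Sum.inl j) ↔ (i : ℕ) + 1 = j ∨ (j : ℕ) + 1 = i := by
  simp [graphN3Two, graphN3_adj_inl_inl]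

lemma graphN3Two_adj_inl_inr {n s : ℕ} {i : Fin 4} {j : Fin (n - 4)} :
    (graphN3Two n s).Adj (Sum.inl i) (Sum.inr j) ↔ i ≠ 0 ∧ (i = 1 → s ≤ j) := by
  simp [graphN3Two, graphN3_adj_inl_inr]
  grind

lemma graphN3Two_adj_inr_inr {n s : ℕ} {i j : Fin (n - 4)} :
    (graphN3Two n s).Adj (Sum.inr i) (Sum.inr j) ↔ i ≠ j := by
  simp [graphN3Two, graphN3_adj_inr_inr]

lemma graphN3Four_adj_inl_inl {n s : ℕ} {i j : Fin 4} :
    (graphN3Four n s).Adj (Sum.inl i) (Sum.inl j) ↔ (i : ℕ) + 1 = j ∨ (j : ℕ) + 1 = i := by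
  simp [graphN3Four, graphN3_adj_inl_inl]

lemma graphN3Four_adj_inl_inr {n s : ℕ} {i : Fin 4} {j : Fin (n - 4)} :
    (graphN3Four n s).Adj (Sum.inl i) (Sum.inr j) ↔ i ≠ 0 ∧ (i = 3 → s ≤ j) := by
  simp [graphN3Four, graphN3_adj_inl_inr]
  grind

lemma graphN3Four_adj_inr_inr {n s : ℕ} {i j : Fin (n - 4)} :
    (graphN3Four n s).Adj (Sum.inr i) (Sum.inr j) ↔ i ≠ j := by
  simp [graphN3Four, graphN3_adj_inr_inr]

lemma graphN3Two_zero (n : ℕ) : graphN3Two n 0 = graphN3 n := by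
  simp [graphN3Two]

lemma graphN3Four_zero (n : ℕ) : graphN3Four n 0 = graphN3 n := by
  simp [graphN3Four]

/-- With this boundary case, both families can be treated together. -/
lemma graphNA_eq_graphNAB {n a b : ℕ} (h : a + b = n - 4) : graphNA n a = graphNAB n a b := by
  have : ∀ j : Fin (n - 4), (j : ℕ) < a + b := fun j => by omega
  simp [graphNA, graphNAB, this]

lemma graphNAB_adj_inl_inl {n a b : ℕ} {i j : Fin 4} :
    (graphNAB n a b).Adj (Sum.inl i) (Sum.inl j) ↔ (i : ℕ) + 1 = j ∨ (j : ℕ) + 1 = i :=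
  SimpleGraph.pathGraph_adj

lemma graphNAB_adj_inl_inr {n a b : ℕ} {i : Fin 4} {j : Fin (n - 4)} :
    (graphNAB n a b).Adj (Sum.inl i) (Sum.inr j) ↔ i = 1 ∨ i = 2 ∨ (i = 0 ∧ (j : ℕ) < a) ∨
      (i = 3 ∧ a ≤ (j : ℕ) ∧ (j : ℕ) < a + b) := Iff.rfl

lemma graphNAB_adj_inr_inr {n a b : ℕ} {i j : Fin (n - 4)} :
    (graphNAB n a b).Adj (Sum.inr i) (Sum.inr j) ↔ i ≠ j := Iff.rfl

lemma graphN3Two_isCliqueOff (n s : ℕ) :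
    (graphN3Two n s).IsCliqueOff (Sum.inl 0) (Sum.inl 1) := by
  rintro (i | i) (j | j) h1 h2 h3 h4 h5
  · rw [graphN3Two_adj_inl_inl]
    revert i j
    simp
    decide
  · rw [graphN3Two_adj_inl_inr]
    grind
  · rw [SimpleGraph.adj_comm, graphN3Two_adj_inl_inr]
    grind
  · rw [graphN3Two_adj_inr_inr]
    grind

lemma graphN3Four_isCliqueOff (n s : ℕ) :
    (graphN3Four n s).IsCliqueOff (Sum.inl 0) (Sum.inl 3) := by
  rintro (i | i) (j | j) h1 h2 h3 h4 h5
  · rw [graphN3Four_adj_inl_inl]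
    revert i j
    simp
    decide
  · rw [graphN3Four_adj_inl_inr]
    grind
  · rw [SimpleGraph.adj_comm, graphN3Four_adj_inl_inr]
    grind
  · rw [graphN3Four_adj_inr_inr]
    grind

lemma graphNAB_isCliqueOff (n a b : ℕ) :
    (graphNAB n a b).IsCliqueOff (Sum.inl 0) (Sum.inl 3) := by
  rintro (i | i) (j | j) h1 h2 h3 h4 h5
  · rw [graphNAB_adj_inl_inl]
    revert i j
    simp
    decide
  · rw [graphNAB_adj_inl_inr]
    grind
  · rw [SimpleGraph.adj_comm, graphNAB_adj_inl_inr]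
    grind
  · rw [graphNAB_adj_inr_inr]
    grind

end Families

/-! ### Recognising the graphs complete off two vertices. -/

section Classification

open SimpleGraph

variable {V : Type*} [Fintype V] [DecidableEq V] {G : SimpleGraph V} [DecidableRel G.Adj]
  {u a b v : V} {n : ℕ}

namespace SimpleGraph.IsGeodesicThree

omit [DecidableRel G.Adj] in
lemma card_filter_le (h : G.IsGeodesicThree u a b v) (hV : Fintype.card V = n) (P : V → Prop)
    [DecidablePred P] : #{w | w ∉ univ.image ![u, a, b, v] ∧ P w} ≤ n - 4 := by
  calc #{w | w ∉ univ.image ![u, a, b, v] ∧ P w} ≤ #((univ.image ![u, a, b, v])ᶜ) :=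
        card_le_card fun w hw => mem_compl.2 (mem_filter.1 hw).2.1
    _ = n - 4 := by
        rw [card_compl, card_image_of_injective _ h.injective, hV, card_univ, Fintype.card_fin]

/-- Every vertex outside the geodesic is adjacent to `v`, hence not to `u`. The only freedom left is
how many of them `a` misses; two classes suffice and class 1 stays empty. -/
lemma nonempty_iso_graphN3Two (h : G.IsGeodesicThree u a b v) (hn : 5 ≤ n)
    (hV : Fintype.card V = n) (hc : G.IsCliqueOff u a) :
    ∃ s ≤ n - 4, Nonempty (G ≃g graphN3Two n s) := by
  obtain ⟨s, hs⟩ : ∃ s, s = #{w | w ∉ univ.image ![u, a, b, v] ∧ ¬ G.Adj a w} := ⟨_, rfl⟩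
  have hle : s ≤ n - 4 := hs ▸ h.card_filter_le hV _
  have hnd := h.nodup
  simp at hnd
  refine ⟨s, hle, nonempty_iso_of_card_classes ![u, a, b, v] h.injective (by omega)
    (fun w => if G.Adj a w then 2 else 0) (fun j => if (j : ℕ) < s then 0 else 2)
    ?_ ?_ ?_ ?_ ?_ ?_⟩
  · have hcard := Fin.card_filter_le_and_lt (m := n - 4) 0 s hle
    rw [tsub_zero, hs] at hcard
    refine Eq.trans ?_ (hcard.symm.trans ?_) <;>
      refine congrArg card (filter_congr fun w _ => ?_) <;> split_ifs <;> simp_all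
  · have e1 : ∀ (q : Prop) [Decidable q], (if q then (2 : Fin 3) else 0) ≠ 1 := by
      intro q _; split_ifs <;> decide
    have e2 : ∀ (q : Prop) [Decidable q], (if q then (0 : Fin 3) else 2) ≠ 1 := by
      intro q _; split_ifs <;> decide
    simp [e1, e2]
  · intro i j
    rw [graphN3Two_adj_inl_inl]
    exact h.adj_iff i j
  · intro i w j hw hcls
    rw [graphN3Two_adj_inl_inr]
    obtain ⟨hwu, hwa, hwb, hwv⟩ := ne_of_notMem_image hw
    have hvw : G.Adj v w := hc v w (by grind) (by grind) hwu hwa hwv.symm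
    have hbw : G.Adj b w := hc b w (by grind) (by grind) hwu hwa hwb.symm
    have huw : ¬ G.Adj u w := fun h' => h.not_adj_of_adj w h' hvw
    have haw : G.Adj a w ↔ s ≤ j := by
      split_ifs at hcls <;> simp_all
    fin_cases i <;> simp [hvw, hbw, huw, haw]
  · intro w w' hw hw' hne
    obtain ⟨hwu, hwa, hwb, hwv⟩ := ne_of_notMem_image hw
    obtain ⟨hwu', hwa', hwb', hwv'⟩ := ne_of_notMem_image hw'
    exact hc w w' hwu hwa hwu' hwa' hne
  · exact fun i j hij => graphN3Two_adj_inr_inr.2 hij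

lemma nonempty_iso_graphN3Four (h : G.IsGeodesicThree u a b v) (hn : 5 ≤ n)
    (hV : Fintype.card V = n) (hc : G.IsCliqueOff u v)
    (hu : ∀ w, w ∉ univ.image ![u, a, b, v] → ¬ G.Adj u w) :
    ∃ s ≤ n - 4, Nonempty (G ≃g graphN3Four n s) := by
  obtain ⟨s, hs⟩ : ∃ s, s = #{w | w ∉ univ.image ![u, a, b, v] ∧ ¬ G.Adj v w} := ⟨_, rfl⟩
  have hle : s ≤ n - 4 := hs ▸ h.card_filter_le hV _
  have hnd := h.nodup
  simp at hnd
  refine ⟨s, hle, nonempty_iso_of_card_classes ![u, a, b, v] h.injective (by omega)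
    (fun w => if G.Adj v w then 2 else 0) (fun j => if (j : ℕ) < s then 0 else 2)
    ?_ ?_ ?_ ?_ ?_ ?_⟩
  · have hcard := Fin.card_filter_le_and_lt (m := n - 4) 0 s hle
    rw [tsub_zero, hs] at hcard
    refine Eq.trans ?_ (hcard.symm.trans ?_) <;>
      refine congrArg card (filter_congr fun w _ => ?_) <;> split_ifs <;> simp_all
  · have e1 : ∀ (q : Prop) [Decidable q], (if q then (2 : Fin 3) else 0) ≠ 1 := by
      intro q _; split_ifs <;> decide
    have e2 : ∀ (q : Prop) [Decidable q], (if q then (0 : Fin 3) else 2) ≠ 1 := by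
      intro q _; split_ifs <;> decide
    simp [e1, e2]
  · intro i j
    rw [graphN3Four_adj_inl_inl]
    exact h.adj_iff i j
  · intro i w j hw hcls
    rw [graphN3Four_adj_inl_inr]
    obtain ⟨hwu, hwa, hwb, hwv⟩ := ne_of_notMem_image hw
    have haw : G.Adj a w := hc a w (by grind) (by grind) hwu hwv hwa.symm
    have hbw : G.Adj b w := hc b w (by grind) (by grind) hwu hwv hwb.symm
    have huw := hu w hw
    have hvw : G.Adj v w ↔ s ≤ j := by
      split_ifs at hcls <;> simp_all
    fin_cases i <;> simp [hvw, hbw, huw, haw]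
  · intro w w' hw hw' hne
    obtain ⟨hwu, hwa, hwb, hwv⟩ := ne_of_notMem_image hw
    obtain ⟨hwu', hwa', hwb', hwv'⟩ := ne_of_notMem_image hw'
    exact hc w w' hwu hwv hwu' hwv' hne
  · exact fun i j hij => graphN3Four_adj_inr_inr.2 hij

lemma card_add_card_le (h : G.IsGeodesicThree u a b v) (hV : Fintype.card V = n) :
    #{w | w ∉ univ.image ![u, a, b, v] ∧ G.Adj u w}
      + #{w | w ∉ univ.image ![u, a, b, v] ∧ G.Adj v w} ≤ n - 4 := by
  rw [← card_union_of_disjoint]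
  · refine le_trans (card_le_card ?_) (h.card_filter_le hV fun w => G.Adj u w ∨ G.Adj v w)
    intro w hw
    simp only [mem_union, mem_filter] at hw ⊢
    tauto
  · rw [disjoint_filter]
    exact fun w _ h1 h2 => h.not_adj_of_adj w h1.2 h2.2

/-- Outside the geodesic all vertices are joined to `a` and `b`, so the classes are the neighbours
of `u`, the neighbours of `v`, and the rest; the first two are disjoint by distance three. -/
lemma nonempty_iso_graphNAB (h : G.IsGeodesicThree u a b v) (hn : 5 ≤ n)
    (hV : Fintype.card V = n) (hc : G.IsCliqueOff u v) {α β : ℕ}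
    (hα : α = #{w | w ∉ univ.image ![u, a, b, v] ∧ G.Adj u w})
    (hβ : β = #{w | w ∉ univ.image ![u, a, b, v] ∧ G.Adj v w}) :
    Nonempty (G ≃g graphNAB n α β) := by
  have hle : α + β ≤ n - 4 := by rw [hα, hβ]; exact h.card_add_card_le hV
  have hnd := h.nodup
  simp at hnd
  refine nonempty_iso_of_card_classes ![u, a, b, v] h.injective (by omega)
    (fun w => if G.Adj u w then 0 else if G.Adj v w then 1 else 2)
    (fun j => if (j : ℕ) < α then 0 else if (j : ℕ) < α + β then 1 else 2)
    ?_ ?_ ?_ ?_ ?_ ?_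
  · have hcard := Fin.card_filter_le_and_lt (m := n - 4) 0 α (by omega)
    rw [tsub_zero] at hcard
    refine Eq.trans ?_ (hα.symm.trans (hcard.symm.trans ?_)) <;>
      refine congrArg card (filter_congr fun w _ => ?_) <;> split_ifs <;> simp_all
  · have hcard := Fin.card_filter_le_and_lt (m := n - 4) α (α + β) hle
    rw [add_tsub_cancel_left] at hcard
    refine Eq.trans ?_ (hβ.symm.trans (hcard.symm.trans ?_)) <;>
      refine congrArg card (filter_congr fun w _ => ?_)
    · have := h.not_adj_of_adj w
      split_ifs <;> simp_all
    · split_ifs <;> simp_all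
  · intro i j
    rw [graphNAB_adj_inl_inl]
    exact h.adj_iff i j
  · intro i w j hw hcls
    rw [graphNAB_adj_inl_inr]
    obtain ⟨hwu, hwa, hwb, hwv⟩ := ne_of_notMem_image hw
    have haw : G.Adj a w := hc a w (by grind) (by grind) hwu hwv hwa.symm
    have hbw : G.Adj b w := hc b w (by grind) (by grind) hwu hwv hwb.symm
    have hno := h.not_adj_of_adj w
    have huw : G.Adj u w ↔ (j : ℕ) < α := by
      split_ifs at hcls <;> simp_all
    have hvw : G.Adj v w ↔ α ≤ j ∧ (j : ℕ) < α + β := by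
      split_ifs at hcls <;> simp_all
    fin_cases i <;> simp [hvw, hbw, huw, haw]
  · intro w w' hw hw' hne
    obtain ⟨hwu, hwa, hwb, hwv⟩ := ne_of_notMem_image hw
    obtain ⟨hwu', hwa', hwb', hwv'⟩ := ne_of_notMem_image hw'
    exact hc w w' hwu hwv hwu' hwv' hne
  · exact fun i j hij => graphNAB_adj_inr_inr.2 hij

end SimpleGraph.IsGeodesicThree

end Classification

section Classification

open SimpleGraph

variable {V : Type*} {G : SimpleGraph V} {n : ℕ}

/-- `G` is isomorphic to one of the extremal graphs on `n` vertices. -/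
def IsDiamThreeExtremal (G : SimpleGraph V) (n : ℕ) : Prop :=
  Nonempty (G ≃g graphN3 n) ∨
    (∃ s : ℕ, 1 ≤ s ∧ s ≤ n - 4 ∧ Nonempty (G ≃g graphN3Two n s)) ∨
    (∃ s : ℕ, 1 ≤ s ∧ s ≤ n - 4 ∧ Nonempty (G ≃g graphN3Four n s)) ∨
    (∃ a : ℕ, 1 ≤ a ∧ (a : ℝ) ≤ (n : ℝ) / 2 - 2 ∧ Nonempty (G ≃g graphNA n a)) ∨
    (∃ a b : ℕ, 1 ≤ a ∧ a ≤ b ∧ a + b ≤ n - 5 ∧ Nonempty (G ≃g graphNAB n a b))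

lemma IsDiamThreeExtremal.exists_isCliqueOff (hn : 5 ≤ n) (h : IsDiamThreeExtremal G n) :
    ∃ x y, G.IsCliqueOff x y := by
  rcases h with ⟨⟨e⟩⟩ | ⟨s, -, -, ⟨e⟩⟩ | ⟨s, -, -, ⟨e⟩⟩ | ⟨a, -, ha, ⟨e⟩⟩ | ⟨a, b, -, -, -, ⟨e⟩⟩
  · rw [← graphN3Two_zero] at e
    exact ⟨_, _, (graphN3Two_isCliqueOff n 0).of_iso e⟩
  · exact ⟨_, _, (graphN3Two_isCliqueOff n s).of_iso e⟩
  · exact ⟨_, _, (graphN3Four_isCliqueOff n s).of_iso e⟩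
  -- The bound on `a` ensures that `n - 4 - a` is not truncated.
  · have h1 : (2 * a + 4 : ℝ) ≤ n := by linarith
    have h2 : 2 * a + 4 ≤ n := by exact_mod_cast h1
    rw [graphNA_eq_graphNAB (b := n - 4 - a) (by omega)] at e
    exact ⟨_, _, (graphNAB_isCliqueOff n a _).of_iso e⟩
  · exact ⟨_, _, (graphNAB_isCliqueOff n a b).of_iso e⟩

variable [Fintype V] [DecidableEq V] [DecidableRel G.Adj] {u a b v : V}

namespace SimpleGraph.IsGeodesicThree

lemma isDiamThreeExtremal_of_isCliqueOff_left (h : G.IsGeodesicThree u a b v) (hn : 5 ≤ n)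
    (hV : Fintype.card V = n) (hc : G.IsCliqueOff u a) : IsDiamThreeExtremal G n := by
  obtain ⟨s, hs, e⟩ := h.nonempty_iso_graphN3Two hn hV hc
  rcases Nat.eq_zero_or_pos s with rfl | hs0
  · exact Or.inl (graphN3Two_zero n ▸ e)
  · exact Or.inr (Or.inl ⟨s, hs0, hs, e⟩)

/-- If `u` has no neighbour outside the geodesic, edges are missing only at `v`; otherwise the two
families with both ends attached differ in whether every outside vertex is a neighbour of an end. -/
lemma isDiamThreeExtremal_of_card_le (h : G.IsGeodesicThree u a b v) (hn : 5 ≤ n)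
    (hV : Fintype.card V = n) (hc : G.IsCliqueOff u v)
    (hle : #{w | w ∉ univ.image ![u, a, b, v] ∧ G.Adj u w}
      ≤ #{w | w ∉ univ.image ![u, a, b, v] ∧ G.Adj v w}) : IsDiamThreeExtremal G n := by
  obtain ⟨α, hα⟩ : ∃ α, α = #{w | w ∉ univ.image ![u, a, b, v] ∧ G.Adj u w} := ⟨_, rfl⟩
  obtain ⟨β, hβ⟩ : ∃ β, β = #{w | w ∉ univ.image ![u, a, b, v] ∧ G.Adj v w} := ⟨_, rfl⟩
  have hadd := h.card_add_card_le hV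
  have e := h.nonempty_iso_graphNAB hn hV hc hα hβ
  rw [← hα, ← hβ] at hle hadd
  rcases Nat.eq_zero_or_pos α with h0 | h0
  · have hu : ∀ w, w ∉ univ.image ![u, a, b, v] → ¬ G.Adj u w := by
      rw [h0, eq_comm, card_eq_zero, filter_eq_empty_iff] at hα
      exact fun w hw huw => hα (mem_univ w) ⟨hw, huw⟩
    obtain ⟨s, hs, e⟩ := h.nonempty_iso_graphN3Four hn hV hc hu
    rcases Nat.eq_zero_or_pos s with rfl | hs0
    · exact Or.inl (graphN3Four_zero n ▸ e)
    · exact Or.inr (Or.inr (Or.inl ⟨s, hs0, hs, e⟩))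
  · rcases hadd.eq_or_lt with heq | hlt
    · refine Or.inr (Or.inr (Or.inr (Or.inl ⟨α, h0, ?_, graphNA_eq_graphNAB heq ▸ e⟩)))
      have : 2 * α + 4 ≤ n := by omega
      have : (2 * α + 4 : ℝ) ≤ n := by exact_mod_cast this
      linarith
    · exact Or.inr (Or.inr (Or.inr (Or.inr ⟨α, β, h0, hle, by omega, e⟩)))

/-- Reversing the geodesic puts the end with fewer outside neighbours first. -/
lemma isDiamThreeExtremal_of_isCliqueOff_ends (h : G.IsGeodesicThree u a b v) (hn : 5 ≤ n)
    (hV : Fintype.card V = n) (hc : G.IsCliqueOff u v) : IsDiamThreeExtremal G n := by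
  have himg : univ.image ![v, b, a, u] = univ.image ![u, a, b, v] := by
    ext w
    simp only [mem_image, mem_univ, true_and, Fin.exists_fin_succ]
    simp
    tauto
  rcases le_total #{w | w ∉ univ.image ![u, a, b, v] ∧ G.Adj u w}
    #{w | w ∉ univ.image ![u, a, b, v] ∧ G.Adj v w} with hle | hle
  · exact h.isDiamThreeExtremal_of_card_le hn hV hc hle
  · exact h.symm.isDiamThreeExtremal_of_card_le hn hV hc.symm (by rwa [himg])

end SimpleGraph.IsGeodesicThree

end Classification

end

theorem theoremd3 {V : Type*} [Fintype V] [DecidableEq V] (G : SimpleGraph V)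
    [DecidableRel G.Adj] (n : ℕ) (hn : 5 ≤ n) (hV : Fintype.card V = n) (hd : G.ediam = 3) :
    laplacianCount G (Set.Icc ((n : ℝ) - 2) n) ≤ n - 3 ∧
    (laplacianCount G (Set.Icc ((n : ℝ) - 2) n) = n - 3 ↔
      Nonempty (G ≃g graphN3 n) ∨
      (∃ s : ℕ, 1 ≤ s ∧ s ≤ n - 4 ∧ Nonempty (G ≃g graphN3Two n s)) ∨
      (∃ s : ℕ, 1 ≤ s ∧ s ≤ n - 4 ∧ Nonempty (G ≃g graphN3Four n s)) ∨
      (∃ a : ℕ, 1 ≤ a ∧ (a : ℝ) ≤ (n : ℝ) / 2 - 2 ∧ Nonempty (G ≃g graphNA n a)) ∨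
      (∃ a b : ℕ, 1 ≤ a ∧ a ≤ b ∧ a + b ≤ n - 5 ∧ Nonempty (G ≃g graphNAB n a b))) := by

  subst hV
  obtain ⟨u, a, b, v, h⟩ := SimpleGraph.exists_isGeodesicThree hd
  have hlt := h.laplacianCount_add_two_lt hn
  refine ⟨by omega, fun heq => ?_, fun hext => ?_⟩
  · rcases h.isCliqueOff_or hn (by omega) with hc | hc | hc
    · exact h.isDiamThreeExtremal_of_isCliqueOff_ends hn rfl hc
    · exact h.isDiamThreeExtremal_of_isCliqueOff_left hn rfl hc
    · exact h.symm.isDiamThreeExtremal_of_isCliqueOff_left hn rfl hc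
  · obtain ⟨x, y, hxy⟩ := IsDiamThreeExtremal.exists_isCliqueOff hn hext
    have := card_sub_three_le_laplacianCount G hxy
    omega
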